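/- Let $P$ be a finite set of points in the Euclidean plane, and let $DT(P)$ be a Delaunay triangulation of $P$: a maximal plane straight-line graph with vertex set $P$ (edges are segments that contain no other point of $P$ and meet only in common endpoints, and no further edge can be added), such that for every edge $\{a,b\}$ there is a circle through $a$ and $b$ with no point of $P$ in its open interior. (No general position is assumed; if $P$ has several Delaunay triangulations, $DT(P)$ is any one of them.) Let $s,r,p\in P$ be such that $\{s,r\}$ and $\{s,p\}$ are edges of $DT(P)$ and $\angle(rsp)\le \pi/4$. Let the wedge $W_{s,r,p}$ be the set of all edges $\{s,x\}$ of $DT(P)$, including $\{s,r\}$ and $\{s,p\}$, such that $x$ lies in the convex cone with apex $s$ spanned by the rays from $s$ through $r$ and through $p$. Suppose that $\{s,r\}$ is a shortest edge in $W_{s,r,p}$, i.e. $|sr|\le |sx|$ for all $\{s,x\}\in W_{s,r,p}$. Then $$\delta_{DT(P)}(r,p)\le \frac{\pi}{2}\,|rp|,$$ where $\delta_{DT(P)}(r,p)$ is the length of a shortest path between $r$ and $p$ in $DT(P)$, the length of a path being the sum of the Euclidean lengths of its edges. -/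

import Mathlib

/-- The Euclidean plane. -/
abbrev Plane : Type := EuclideanSpace ℝ (Fin 2)

/-- `G` is a plane straight-line graph on the point set `P`: every edge `{a, b}` is drawn as the
segment from `a` to `b`, it contains no point of `P` besides its end points, and two different edges
meet only in common end points. -/
structure IsPlaneStraightLine {P : Finset Plane} (G : SimpleGraph P) : Prop where
  vertex_free : ∀ a b x : P, G.Adj a b →
    (x : Plane) ∈ segment ℝ (a : Plane) (b : Plane) → x = a ∨ x = b
  noncrossing : ∀ a b c d : P, G.Adj a b → G.Adj c d → s(a, b) ≠ s(c, d) →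
    segment ℝ (a : Plane) (b : Plane) ∩ segment ℝ (c : Plane) (d : Plane) ⊆
      ({(a : Plane), (b : Plane)} : Set Plane) ∩ {(c : Plane), (d : Plane)}

/-- Some circle passes through `a` and `b` and has no point of `P` in its open interior. -/
def HasEmptyCircle (P : Finset Plane) (a b : Plane) : Prop :=
  ∃ (c : Plane) (ρ : ℝ), dist a c = ρ ∧ dist b c = ρ ∧ ∀ x ∈ P, ρ ≤ dist x c

/-- `G` is (the edge graph of) a Delaunay triangulation of `P`: a triangulation of `P`, that is, a
plane straight-line graph with vertex set `P` to which no edge can be added, all of whose edges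
have the empty circle property. No general position is assumed; if there are cocircular points,
then `P` may have several Delaunay triangulations. -/
structure IsDelaunayTriangulation {P : Finset Plane} (G : SimpleGraph P) : Prop where
  triangulation : Maximal (fun H : SimpleGraph P => IsPlaneStraightLine H) G
  empty_circle : ∀ a b : P, G.Adj a b → HasEmptyCircle P a b

/-- The neighbours `x` of `s` in `G` such that the edge `{s, x}` belongs to the wedge spanned at `s`
by the neighbours `r` and `p` (end points of the range included): those that lie in the convex
cone with apex `s` spanned by the rays from `s` through `r` and through `p`. For
`∠ r s p < π` these are the neighbours of `s` from `r` to `p` in the angular order around `s`,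
taken through the angle `∠ r s p`. -/
def wedgeNeighbors {P : Finset Plane} (G : SimpleGraph P) (s r p : P) : Set P :=
  {x | G.Adj s x ∧ ∃ u v : ℝ, 0 ≤ u ∧ 0 ≤ v ∧
    (x : Plane) - (s : Plane) =
      u • ((r : Plane) - (s : Plane)) + v • ((p : Plane) - (s : Plane))}

/-- The wedge: the set of edges joining `s` to its neighbours from `r` to `p`. -/
def wedge {P : Finset Plane} (G : SimpleGraph P) (s r p : P) : Set (Sym2 P) :=
  (fun x => s(s, x)) '' wedgeNeighbors G s r p

/-- The Euclidean length of an edge. -/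
noncomputable def edgeLength {P : Finset Plane} (e : Sym2 P) : ℝ :=
  Sym2.lift ⟨fun a b : P => dist (a : Plane) (b : Plane), fun a b => dist_comm (a : Plane) b⟩ e

/-- The Euclidean length of a walk: the sum of the lengths of its edges, with multiplicity. -/
noncomputable def walkLength {P : Finset Plane} {G : SimpleGraph P} {a b : P}
    (w : G.Walk a b) : ℝ :=
  (w.edges.map edgeLength).sum

/-- The shortest-path distance in `G` with respect to Euclidean edge lengths; it is `⊤` when there
is no path. -/
noncomputable def graphDist {P : Finset Plane} (G : SimpleGraph P) (a b : P) : ENNReal :=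
  ⨅ w : G.Walk a b, ENNReal.ofReal (walkLength w)

/-! Take `s` as origin and `|sr|` as unit of length, with `r = (1, 0)` and `p` at a polar angle
between 0 and π/4. The path is the fan of wedge neighbours of `s` in angular order. Consecutive ones
are adjacent, because in a maximal plane graph nothing can obstruct the segment between them
(`ConeCoordinates.adj`).

A circle through `s` and `r` has polar equation ρ = cos θ + a sin θ and diameter √(1 + a²). Since
`r` is not inside the empty circles of the edges at `s`, the parameter a of the circle through `s`,
`r` and a neighbour does not decrease with θ (`circle_parameter_mono`). Hence each neighbour q lies
in the disk belonging to its successor x, and there |qx| ≤ Φ(x) - Φ(q) for the potential Φ = ρ + sin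
θ - b cos θ with b = max(a_p, 71/50) (`dist_le_potential_sub`). The fan length telescopes to at most
Φ(p) - Φ(r), which is at most π/2 · √(1 + a_p²) sin θ_p = π/2 · |rp| (`potential_le_arc`,
`chord_eq`). -/

/-! ### Maximality of plane graphs -/

/-- Otherwise the edge could be added. Only the ends of the new edge need checking: a vertex lying
on an old edge is automatically an end of it. -/
theorem IsPlaneStraightLine.adj_of_maximal {P : Finset Plane} {G : SimpleGraph P}
    (hG : Maximal (fun H : SimpleGraph P => IsPlaneStraightLine H) G) {a b : P} (hab : a ≠ b)
    (hfree : ∀ x : P, (x : Plane) ∈ segment ℝ (a : Plane) (b : Plane) → x = a ∨ x = b)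
    (hcross : ∀ c d : P, G.Adj c d → s(a, b) ≠ s(c, d) → ∀ q : Plane,
      q ∈ segment ℝ (a : Plane) (b : Plane) → q ∈ segment ℝ (c : Plane) (d : Plane) →
      q = a ∨ q = b) : G.Adj a b := by
  have hG' : IsPlaneStraightLine G := hG.prop
  have hcross' : ∀ c d : P, G.Adj c d → s(a, b) ≠ s(c, d) → ∀ q : Plane,
      q ∈ segment ℝ (a : Plane) (b : Plane) → q ∈ segment ℝ (c : Plane) (d : Plane) →
      (q = a ∨ q = b) ∧ (q = c ∨ q = d) := by
    intro c d hcd hne q hq1 hq2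
    have h := hcross c d hcd hne q hq1 hq2
    refine ⟨h, ?_⟩
    rcases h with h | h
    · subst h
      exact (hG'.vertex_free c d a hcd hq2).imp (congrArg _) (congrArg _)
    · subst h
      exact (hG'.vertex_free c d b hcd hq2).imp (congrArg _) (congrArg _)
  have hH : ∀ c d : P, (G ⊔ SimpleGraph.edge a b).Adj c d ↔ G.Adj c d ∨ s(a, b) = s(c, d) := by
    intro c d
    rw [SimpleGraph.sup_adj, SimpleGraph.edge_adj, Sym2.eq_iff]
    constructor
    · rintro (h | ⟨h, -⟩)
      · exact Or.inl h
      · exact Or.inr (h.imp (fun h => ⟨h.1.symm, h.2.symm⟩) fun h => ⟨h.2.symm, h.1.symm⟩)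
    · rintro (h | h)
      · exact Or.inl h
      · refine Or.inr ⟨h.imp (fun h => ⟨h.1.symm, h.2.symm⟩) fun h => ⟨h.2.symm, h.1.symm⟩, ?_⟩
        rcases h with ⟨rfl, rfl⟩ | ⟨rfl, rfl⟩
        · exact hab
        · exact hab.symm
  have hle : G ⊔ SimpleGraph.edge a b ≤ G := by
    refine hG.le_of_ge ?_ le_sup_left
    constructor
    · intro c d x hcd hx
      rcases (hH c d).1 hcd with h | h
      · exact hG'.vertex_free c d x h hx
      · rcases Sym2.eq_iff.1 h with ⟨rfl, rfl⟩ | ⟨rfl, rfl⟩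
        · exact hfree x hx
        · rw [segment_symm] at hx
          exact (hfree x hx).symm
    · rintro c d e f hcd hef hne q ⟨hq1, hq2⟩
      rcases (hH c d).1 hcd with h | h <;> rcases (hH e f).1 hef with h' | h'
      · exact hG'.noncrossing c d e f h h' hne ⟨hq1, hq2⟩
      · have hne' : s(a, b) ≠ s(c, d) := by rw [h']; exact hne.symm
        have hseg : q ∈ segment ℝ (a : Plane) (b : Plane) := by
          rcases Sym2.eq_iff.1 h' with ⟨rfl, rfl⟩ | ⟨rfl, rfl⟩
          · exact hq2
          · rwa [segment_symm]
        obtain ⟨h1, h2⟩ := hcross' c d h hne' q hseg hq1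
        refine ⟨h2, ?_⟩
        rcases Sym2.eq_iff.1 h' with ⟨rfl, rfl⟩ | ⟨rfl, rfl⟩
        · exact h1
        · exact h1.symm
      · have hne' : s(a, b) ≠ s(e, f) := by rw [h]; exact hne
        have hseg : q ∈ segment ℝ (a : Plane) (b : Plane) := by
          rcases Sym2.eq_iff.1 h with ⟨rfl, rfl⟩ | ⟨rfl, rfl⟩
          · exact hq1
          · rwa [segment_symm]
        obtain ⟨h1, h2⟩ := hcross' e f h' hne' q hseg hq2
        refine ⟨?_, h2⟩
        rcases Sym2.eq_iff.1 h with ⟨rfl, rfl⟩ | ⟨rfl, rfl⟩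
        · exact h1
        · exact h1.symm
      · exact absurd (h.symm.trans h') hne
  exact hle ((hH a b).2 (Or.inr rfl))

/-! ### Consecutive neighbours of a vertex are adjacent -/

/-- `l` and `m` are the coordinates with respect to the basis `x - s`, `y - s` of the plane. -/
structure ConeCoordinates (s x y : Plane) (l m : Plane →ₗ[ℝ] ℝ) : Prop where
  expand : ∀ v, v = l v • (x - s) + m v • (y - s)
  fst_left : l (x - s) = 1
  snd_left : m (x - s) = 0
  fst_right : l (y - s) = 0
  snd_right : m (y - s) = 1

namespace ConeCoordinates

variable {P : Finset Plane} {G : SimpleGraph P} {s x y : P} {l m : Plane →ₗ[ℝ] ℝ}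

theorem symm {s x y : Plane} (h : ConeCoordinates s x y l m) : ConeCoordinates s y x m l :=
  ⟨fun v => by rw [add_comm]; exact h.expand v, h.snd_right, h.fst_right, h.snd_left, h.fst_left⟩

theorem ext {s x y : Plane} (h : ConeCoordinates s x y l m) {q q' : Plane}
    (h1 : l (q - s) = l (q' - s)) (h2 : m (q - s) = m (q' - s)) : q = q' := by
  have := h.expand (q - s)
  rw [h1, h2, ← h.expand] at this
  exact sub_left_injective this

theorem mem_segment {s x y : Plane} (h : ConeCoordinates s x y l m) {q : Plane}
    (h1 : l (q - s) = 0) (h2 : 0 ≤ m (q - s)) (h3 : m (q - s) ≤ 1) : q ∈ segment ℝ s y := by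
  rw [segment_eq_image']
  refine ⟨m (q - s), ⟨h2, h3⟩, h.ext ?_ ?_⟩ <;>
    simp [h.fst_right, h.snd_right, h1]

theorem eq_of_fst_eq_zero (h : ConeCoordinates (s : Plane) x y l m) (hG : IsPlaneStraightLine G)
    (hy : G.Adj s y) {e : P} (h1 : l (e - s) = 0) (h2 : 0 ≤ m (e - s)) (h3 : m (e - s) ≤ 1) :
    e = s ∨ e = y :=
  hG.vertex_free s y e hy (h.mem_segment h1 h2 h3)

/-- The point `z` would be a crossing of `cd` with the edge `sy`, hence an end of `cd`; but `l` is
negative at `c`, positive at `d` and zero at `z`. -/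
theorem no_exit (h : ConeCoordinates (s : Plane) x y l m) (hG : IsPlaneStraightLine G)
    (hy : G.Adj s y) {c d : P} (hcd : G.Adj c d) {q z : Plane}
    (hq : q ∈ segment ℝ (c : Plane) d) (hlq : 0 < l (q - s)) (hlc : l (c - s) < 0)
    (hz : z ∈ segment ℝ (c : Plane) d)
    (h1 : l (z - s) = 0) (h2 : 0 ≤ m (z - s)) (h3 : m (z - s) ≤ 1) : False := by
  have hld : 0 < l (d - s) := by
    rw [segment_eq_image'] at hq
    obtain ⟨t, ⟨ht0, ht1⟩, rfl⟩ := hq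
    have e : l ((c : Plane) + t • ((d : Plane) - c) - s) =
        (1 - t) * l (c - s) + t * l (d - s) := by
      simp only [map_sub, map_add, map_smul, smul_eq_mul]; ring
    rw [e] at hlq
    by_contra hcon
    push Not at hcon
    nlinarith [mul_nonneg (sub_nonneg.2 ht1) (neg_nonneg.2 hlc.le),
      mul_nonneg ht0 (neg_nonneg.2 hcon)]
  have hne : s(s, y) ≠ s(c, d) := by
    intro he
    rcases Sym2.eq_iff.1 he with ⟨rfl, rfl⟩ | ⟨rfl, rfl⟩
    · simp at hlc
    · simp at hld
  have := hG.noncrossing s y c d hy hcd hne ⟨h.mem_segment h1 h2 h3, hz⟩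
  rcases this.2 with rfl | hzd
  · exact hlc.ne h1
  · rw [Set.mem_singleton_iff] at hzd
    subst hzd
    exact hld.ne' h1

/-- An edge that enters the open triangle `s x y` has an end point in the closed triangle. -/
theorem exists_endpoint_aux (h : ConeCoordinates (s : Plane) x y l m) (hG : IsPlaneStraightLine G)
    (hx : G.Adj s x) (hy : G.Adj s y)
    (hno : ∀ z : P, G.Adj s z → ¬ (0 < l (z - s) ∧ 0 < m (z - s))) {c d : P} (hcd : G.Adj c d)
    {q : Plane} (hq : q ∈ segment ℝ (c : Plane) d) (hlq : 0 < l (q - s)) (hmq : 0 < m (q - s))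
    (hhq : l (q - s) + m (q - s) ≤ 1)
    (hc : l (c - s) + m (c - s) ≤ l (q - s) + m (q - s)) :
    0 ≤ l (c - s) ∧ 0 ≤ m (c - s) ∧ c ≠ s := by
  have hpt : ∀ t : ℝ, 0 ≤ t → t ≤ 1 → q + t • ((c : Plane) - q) ∈ segment ℝ (c : Plane) d := by
    intro t h0 h1
    exact (convex_segment (c : Plane) d).segment_subset hq (left_mem_segment ℝ _ _)
      (by rw [segment_eq_image']; exact ⟨t, ⟨h0, h1⟩, rfl⟩)
  have hval : ∀ (f : Plane →ₗ[ℝ] ℝ) (t : ℝ), f (q + t • ((c : Plane) - q) - s) =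
      f (q - s) + t * (f (c - s) - f (q - s)) := by
    intro f t
    simp only [map_sub, map_add, map_smul, smul_eq_mul]; ring
  have hcs : c ≠ s := by
    rintro rfl
    refine hno d hcd ?_
    rw [segment_eq_image'] at hq
    obtain ⟨t, ⟨ht0, ht1⟩, rfl⟩ := hq
    simp only [add_sub_cancel_left, map_smul, smul_eq_mul] at hlq hmq
    exact ⟨pos_of_mul_pos_right hlq ht0, pos_of_mul_pos_right hmq ht0⟩
  set lq := l (q - s)
  set mq := m (q - s)
  set lc := l ((c : Plane) - s) with hlc
  set mc := m ((c : Plane) - s) with hmc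
  by_contra hcon
  have hneg : lc < 0 ∨ mc < 0 := by
    by_contra hh
    push Not at hh
    exact hcon ⟨hh.1, hh.2, hcs⟩
  -- From `q` to `c` the sum `l + m` stays at most 1. So if `c` lies beyond the line `l = 0`,
  -- `no_exit` forces the crossing with this line to have `m < 0`. The bounds `key1` and `key2`
  -- exclude each other, and each fails when the other coordinate of `c` is nonnegative.
  have key1 : lc < 0 → mq * (lq - lc) + lq * (mc - mq) < 0 := by
    intro hl
    by_contra hh
    push Not at hh
    have hd : 0 < lq - lc := by linarith
    have ht0 : 0 ≤ lq / (lq - lc) := by positivity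
    have ht1 : lq / (lq - lc) ≤ 1 := by rw [div_le_one hd]; linarith
    have e1 : lq + lq / (lq - lc) * (lc - lq) = 0 := by field_simp; ring
    have e2 : mq + lq / (lq - lc) * (mc - mq) =
        (mq * (lq - lc) + lq * (mc - mq)) / (lq - lc) := by field_simp
    refine h.no_exit hG hy hcd hq hlq hl (hpt _ ht0 ht1) ?_ ?_ ?_
    · rw [hval]; exact e1
    · rw [hval, e2]; positivity
    · rw [hval]
      change mq + lq / (lq - lc) * (mc - mq) ≤ 1
      nlinarith [mul_nonneg ht0 (sub_nonneg.2 hc)]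
  have key2 : mc < 0 → lq * (mq - mc) + mq * (lc - lq) < 0 := by
    intro hl
    by_contra hh
    push Not at hh
    have hd : 0 < mq - mc := by linarith
    have ht0 : 0 ≤ mq / (mq - mc) := by positivity
    have ht1 : mq / (mq - mc) ≤ 1 := by rw [div_le_one hd]; linarith
    have e1 : mq + mq / (mq - mc) * (mc - mq) = 0 := by field_simp; ring
    have e2 : lq + mq / (mq - mc) * (lc - lq) =
        (lq * (mq - mc) + mq * (lc - lq)) / (mq - mc) := by field_simp
    refine h.symm.no_exit hG hx hcd hq hmq hl (hpt _ ht0 ht1) ?_ ?_ ?_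
    · rw [hval]; exact e1
    · rw [hval, e2]; positivity
    · rw [hval]
      change lq + mq / (mq - mc) * (lc - lq) ≤ 1
      nlinarith [mul_nonneg ht0 (sub_nonneg.2 hc)]
  rcases hneg with hl | hl
  · have k1 := key1 hl
    by_cases hm : mc < 0
    · have k2 := key2 hm
      nlinarith
    · push Not at hm
      nlinarith [mul_nonneg hlq.le hm, mul_pos hmq (neg_pos.2 hl)]
  · have k1 := key2 hl
    by_cases hm : lc < 0
    · have k2 := key1 hm
      nlinarith
    · push Not at hm
      nlinarith [mul_nonneg hmq.le hm, mul_pos hlq (neg_pos.2 hl)]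

theorem exists_endpoint (h : ConeCoordinates (s : Plane) x y l m) (hG : IsPlaneStraightLine G)
    (hx : G.Adj s x) (hy : G.Adj s y)
    (hno : ∀ z : P, G.Adj s z → ¬ (0 < l (z - s) ∧ 0 < m (z - s))) {c d : P} (hcd : G.Adj c d)
    {q : Plane} (hq : q ∈ segment ℝ (c : Plane) d) (hlq : 0 < l (q - s)) (hmq : 0 < m (q - s))
    (hhq : l (q - s) + m (q - s) ≤ 1) :
    ∃ e f : P, s(e, f) = s(c, d) ∧ l (e - s) + m (e - s) ≤ l (q - s) + m (q - s) ∧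
      0 ≤ l (e - s) ∧ 0 ≤ m (e - s) ∧ e ≠ s := by
  by_cases hc : l (c - s) + m (c - s) ≤ l (q - s) + m (q - s)
  · exact ⟨c, d, rfl, hc, h.exists_endpoint_aux hG hx hy hno hcd hq hlq hmq hhq hc⟩
  · have hd : l (d - s) + m (d - s) ≤ l (q - s) + m (q - s) := by
      obtain ⟨t, ⟨ht0, ht1⟩, rfl⟩ := (segment_eq_image' ℝ (c : Plane) d).subset hq
      have hval : ∀ (f : Plane →ₗ[ℝ] ℝ), f ((c : Plane) + t • ((d : Plane) - c) - s) =
          (1 - t) * f (c - s) + t * f (d - s) := by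
        intro f
        simp only [map_sub, map_add, map_smul, smul_eq_mul]; ring
      simp only [hval] at hc ⊢
      push Not at hc
      have h1 : 0 < t * (l (c - s) + m (c - s) - (l (d - s) + m (d - s))) := by linarith
      have h2 := mul_nonneg (sub_nonneg.2 ht1) (pos_of_mul_pos_right h1 ht0).le
      linarith
    rw [segment_symm] at hq
    exact ⟨d, c, Sym2.eq_swap, hd, h.exists_endpoint_aux hG hx hy hno hcd.symm hq hlq hmq hhq hd⟩

/-- The triangle spanned by consecutive neighbours contains no further point. -/
theorem triangle_empty (h : ConeCoordinates (s : Plane) x y l m)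
    (hG : Maximal (fun H : SimpleGraph P => IsPlaneStraightLine H) G)
    (hx : G.Adj s x) (hy : G.Adj s y)
    (hno : ∀ z : P, G.Adj s z → ¬ (0 < l (z - s) ∧ 0 < m (z - s))) (z : P)
    (hl : 0 < l (z - s)) (hm : 0 < m (z - s)) : 1 < l (z - s) + m (z - s) := by
  by_contra hh
  push Not at hh
  have hG' : IsPlaneStraightLine G := hG.prop
  classical
  let Z : Finset P := Finset.univ.filter fun z : P =>
    0 < l (z - s) ∧ 0 < m (z - s) ∧ l (z - s) + m (z - s) ≤ 1
  -- A point of the triangle with least `l + m` sees `s`: an edge blocking the view would have an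
  -- end in the closed triangle at which `l + m` is no larger than at the blocking point. This makes
  -- `w` a neighbour of `s`, against `hno`.
  obtain ⟨w, hw, hmin⟩ := Z.exists_min_image (fun z => l (z - s) + m (z - s))
    ⟨z, by simp only [Z, Finset.mem_filter, Finset.mem_univ, true_and]; exact ⟨hl, hm, hh⟩⟩
  simp only [Z, Finset.mem_filter, Finset.mem_univ, true_and, and_imp] at hw hmin
  obtain ⟨hlw, hmw, hhw⟩ := hw
  have hsw : s ≠ w := by
    rintro rfl
    simp at hlw
  refine hno w (IsPlaneStraightLine.adj_of_maximal hG hsw ?_ ?_) ⟨hlw, hmw⟩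
  · intro v hv
    rw [segment_eq_image'] at hv
    obtain ⟨t, ⟨ht0, ht1⟩, hv : (s : Plane) + t • ((w : Plane) - s) = v⟩ := hv
    have hv' : ((v : Plane) - s) = t • ((w : Plane) - s) := by rw [← hv]; simp
    rcases ht0.eq_or_lt with rfl | ht0
    · left
      simp at hv
      exact hv.symm
    rcases ht1.eq_or_lt with rfl | ht1
    · right
      simp at hv
      exact hv.symm
    exfalso
    have := hmin v
    rw [hv'] at this
    simp only [map_smul, smul_eq_mul] at this
    have := this (by positivity) (by positivity) (by nlinarith)
    nlinarith
  · intro c d hcd _ q hq1 hq2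
    rw [segment_eq_image'] at hq1
    obtain ⟨t, ⟨ht0, ht1⟩, hv⟩ := hq1
    have hv' : (q - s) = t • ((w : Plane) - s) := by rw [← hv]; simp
    rcases ht0.eq_or_lt with rfl | ht0
    · left
      simp at hv
      exact hv.symm
    right
    have key : l (w - s) + m (w - s) ≤ l (q - s) + m (q - s) → q = w := by
      intro hle
      rw [hv'] at hle
      simp only [map_smul, smul_eq_mul] at hle
      have : t = 1 := by nlinarith
      rw [← hv, this]; simp
    have hlq : 0 < l (q - s) := by rw [hv', map_smul]; exact mul_pos ht0 hlw
    have hmq : 0 < m (q - s) := by rw [hv', map_smul]; exact mul_pos ht0 hmw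
    have hhq : l (q - s) + m (q - s) ≤ l (w - s) + m (w - s) := by
      rw [hv']; simp only [map_smul, smul_eq_mul]; nlinarith
    obtain ⟨e, f, -, hhe, hle, hme, hes⟩ :=
      h.exists_endpoint hG' hx hy hno hcd hq2 hlq hmq (hhq.trans hhw)
    apply key
    rcases hle.eq_or_lt with hle | hle
    · rcases h.eq_of_fst_eq_zero hG' hy hle.symm hme (by linarith) with rfl | rfl
      · exact absurd rfl hes
      · rw [h.fst_right, h.snd_right] at hhe
        linarith
    rcases hme.eq_or_lt with hme | hme
    · rcases h.symm.eq_of_fst_eq_zero hG' hx hme.symm hle.le (by linarith) with rfl | rfl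
      · exact absurd rfl hes
      · rw [h.fst_left, h.snd_left] at hhe
        linarith
    exact (hmin e hle hme (by linarith)).trans hhe

/-- Such an edge runs along the line `xy`. As the triangle is empty, `d` cannot lie strictly between
`x` and `y`, so `y` lies on the edge and must be its end. -/
theorem edge_eq_of_left (h : ConeCoordinates (s : Plane) x y l m)
    (hG : IsPlaneStraightLine G)
    (hempty : ∀ z : P, 0 < l (z - s) → 0 < m (z - s) → 1 < l (z - s) + m (z - s))
    {d : P} (hxd : G.Adj x d) {q : Plane} (hq : q ∈ segment ℝ (x : Plane) d)
    (hm : 0 < m (q - s)) (hh : l (q - s) + m (q - s) = 1) : d = y := by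
  rw [segment_eq_image'] at hq
  obtain ⟨t, ⟨ht0, ht1⟩, hv⟩ := hq
  have hval : ∀ (f : Plane →ₗ[ℝ] ℝ), f (q - s) = (1 - t) * f (x - s) + t * f (d - s) := by
    intro f
    rw [← hv]
    simp only [map_sub, map_add, map_smul, smul_eq_mul]; ring
  rw [hval l, hval m, h.fst_left, h.snd_left] at hh
  rw [hval m, h.snd_left] at hm
  have ht : 0 < t := by
    rcases ht0.eq_or_lt with rfl | ht
    · simp at hm
    · exact ht
  have hmd : 0 < m (d - s) := by
    have : 0 < t * m (d - s) := by linarith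
    exact pos_of_mul_pos_right this ht0
  have hhd : l (d - s) + m (d - s) = 1 := by
    have : t * (l (d - s) + m (d - s) - 1) = 0 := by linarith
    rcases mul_eq_zero.1 this with h | h
    · exact absurd h ht.ne'
    · linarith
  have hld : l (d - s) ≤ 0 := by
    by_contra hcon
    push Not at hcon
    linarith [hempty d hcon hmd]
  have hy : (y : Plane) ∈ segment ℝ (x : Plane) d := by
    rw [segment_eq_image']
    have hpos : 0 < m (d - s) := hmd
    refine ⟨1 / m (d - s), ⟨by positivity, by rw [div_le_one hpos]; linarith⟩, h.ext ?_ ?_⟩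
    · have : l ((x : Plane) + (1 / m (d - s)) • ((d : Plane) - x) - s) =
          l (x - s) + (1 / m (d - s)) * (l (d - s) - l (x - s)) := by
        simp only [map_sub, map_add, map_smul, smul_eq_mul]; ring
      simp only [this, h.fst_left, h.fst_right]
      have e : l (d - s) = 1 - m (d - s) := by linarith
      rw [e]; field_simp; ring
    · have : m ((x : Plane) + (1 / m (d - s)) • ((d : Plane) - x) - s) =
          m (x - s) + (1 / m (d - s)) * (m (d - s) - m (x - s)) := by
        simp only [map_sub, map_add, map_smul, smul_eq_mul]; ring
      simp only [this, h.snd_left, h.snd_right]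
      field_simp; ring
  rcases hG.vertex_free x d y hxd hy with hyx | hyd
  · exfalso
    have := h.fst_right
    rw [hyx, h.fst_left] at this
    exact one_ne_zero this
  · exact hyd.symm

/-- Consecutive neighbours of a vertex that span an angle less than `π` are adjacent. -/
theorem adj (h : ConeCoordinates (s : Plane) x y l m)
    (hG : Maximal (fun H : SimpleGraph P => IsPlaneStraightLine H) G)
    (hx : G.Adj s x) (hy : G.Adj s y)
    (hno : ∀ z : P, G.Adj s z → ¬ (0 < l (z - s) ∧ 0 < m (z - s))) : G.Adj x y := by
  have hempty := h.triangle_empty hG hx hy hno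
  have hG' : IsPlaneStraightLine G := hG.prop
  have hxy : x ≠ y := by
    rintro rfl
    exact one_ne_zero (h.fst_left.symm.trans h.fst_right)
  have hseg : ∀ q : Plane, q ∈ segment ℝ (x : Plane) y → q = x ∨ q = y ∨
      (0 < l (q - s) ∧ 0 < m (q - s) ∧ l (q - s) + m (q - s) = 1) := by
    intro q hq
    rw [segment_eq_image'] at hq
    obtain ⟨t, ⟨ht0, ht1⟩, hv⟩ := hq
    have hval : ∀ (f : Plane →ₗ[ℝ] ℝ), f (q - s) = (1 - t) * f (x - s) + t * f (y - s) := by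
      intro f
      rw [← hv]
      simp only [map_sub, map_add, map_smul, smul_eq_mul]; ring
    rcases ht0.eq_or_lt with rfl | ht0
    · left
      rw [← hv]; simp
    rcases ht1.eq_or_lt with rfl | ht1
    · right; left
      rw [← hv]; simp
    right; right
    rw [hval l, hval m, h.fst_left, h.fst_right, h.snd_left, h.snd_right]
    refine ⟨by linarith, by linarith, by ring⟩
  refine IsPlaneStraightLine.adj_of_maximal hG hxy ?_ ?_
  · intro v hv
    rcases hseg v hv with hv | hv | ⟨h1, h2, h3⟩
    · exact Or.inl (Subtype.ext hv)
    · exact Or.inr (Subtype.ext hv)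
    · linarith [hempty v h1 h2]
  · intro c d hcd hne q hq1 hq2
    rcases hseg q hq1 with hv | hv | ⟨h1, h2, h3⟩
    · exact Or.inl hv
    · exact Or.inr hv
    exfalso
    -- The end `e` is not in the open cone since the triangle is empty, so it is on a side at `s`,
    -- hence `x` or `y`; then the crossing edge is `xy` itself.
    obtain ⟨e, f, hef, hhe, hle, hme, hes⟩ :=
      h.exists_endpoint hG' hx hy hno hcd hq2 h1 h2 h3.le
    have hadj : G.Adj e f := by
      rw [← SimpleGraph.mem_edgeSet, hef]; exact hcd
    have hqef : q ∈ segment ℝ (e : Plane) f := by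
      rcases Sym2.eq_iff.1 hef with ⟨rfl, rfl⟩ | ⟨rfl, rfl⟩
      · exact hq2
      · rwa [segment_symm]
    rw [← hef] at hne
    rcases hle.eq_or_lt with hle | hle
    · rcases h.eq_of_fst_eq_zero hG' hy hle.symm hme (by linarith) with rfl | rfl
      · exact hes rfl
      · have := h.symm.edge_eq_of_left hG' (fun z a b => by linarith [hempty z b a]) hadj hqef h1
          (by linarith)
        exact hne (by rw [this]; exact Sym2.eq_swap)
    rcases hme.eq_or_lt with hme | hme
    · rcases h.symm.eq_of_fst_eq_zero hG' hx hme.symm hle.le (by linarith) with rfl | rfl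
      · exact hes rfl
      · have := h.edge_eq_of_left hG' hempty hadj hqef h2 h3
        exact hne (by rw [this])
    · linarith [hempty e hle hme]

end ConeCoordinates

/-! ### Trigonometric estimates on a circle through the apex -/

theorem le_one_of_sq_add_sq {c s : ℝ} (h : c ^ 2 + s ^ 2 = 1) : c ≤ 1 := by
  nlinarith [sq_nonneg s]

theorem cos_bound {c s : ℝ} (h : c ^ 2 + s ^ 2 = 1) (hs : 0 < s) (hcs : s ≤ c) :
    7071 / 10000 ≤ c ∧ c < 1 := by
  constructor <;> nlinarith

/-- This is tan(θ/2) ≤ tan(π/8) = √2 - 1 for θ ≤ π/4; the constant 0.4143 lies just above √2 - 1. -/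
theorem one_sub_cos_le {k c s : ℝ} (h : c ^ 2 + s ^ 2 = 1) (hs : 0 < s) (hcs : s ≤ c)
    (hk : 4143 / 10000 ≤ k) : 1 - c ≤ k * s := by
  obtain ⟨h1, h2⟩ := cos_bound h hs hcs
  refine le_trans ?_ (mul_le_mul_of_nonneg_right hk hs.le)
  by_contra! hcon
  have h3 : (4143 / 10000) ^ 2 * (1 - c ^ 2) < (1 - c) ^ 2 := by
    rw [show 1 - c ^ 2 = s ^ 2 by linarith, ← mul_pow]
    exact pow_lt_pow_left₀ hcon (by positivity) (by norm_num)
  have h4 : (1 - c) * ((4143 / 10000) ^ 2 * (1 + c) - (1 - c)) < 0 := by linarith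
  nlinarith [mul_nonneg (sub_nonneg.2 h2.le) (sub_nonneg.2 h1)]

/-- Monotonicity of tan(θ/2) = (1 - cos θ)/sin θ, with denominators cleared. -/
theorem one_sub_cos_mul_le {c₁ s₁ c₂ s₂ : ℝ} (h₁ : c₁ ^ 2 + s₁ ^ 2 = 1)
    (h₂ : c₂ ^ 2 + s₂ ^ 2 = 1) (hs₁ : 0 ≤ s₁) (hs₂ : 0 < s₂) (hc₁ : 0 < c₁) (hc₂ : 0 < c₂)
    (hsin : 0 ≤ c₁ * s₂ - s₁ * c₂) : s₂ * (1 - c₁) ≤ s₁ * (1 - c₂) := by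
  have h3 : s₁ ≤ s₂ := by
    by_contra! hcon
    have hlt : c₁ < c₂ := lt_of_pow_lt_pow_left₀ 2 hc₂.le (by nlinarith)
    linarith [mul_lt_mul_of_pos_right hlt hs₂, mul_lt_mul_of_pos_right hcon hc₂]
  have h4 : c₂ ≤ c₁ := le_of_not_gt fun hlt => by
    nlinarith [mul_lt_mul'' hlt hlt hc₁.le hc₁.le]
  have e1 : s₂ * (1 - c₁) * ((1 + c₁) * (1 + c₂)) = s₁ * (s₁ * s₂ * (1 + c₂)) := by
    linear_combination (-(s₂ * (1 + c₂))) * h₁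
  have e2 : s₁ * (1 - c₂) * ((1 + c₁) * (1 + c₂)) = s₂ * (s₁ * s₂ * (1 + c₁)) := by
    linear_combination (-(s₁ * (1 + c₁))) * h₂
  refine le_of_mul_le_mul_right ?_ (show 0 < (1 + c₁) * (1 + c₂) by positivity)
  rw [e1, e2]
  gcongr

/-- Two points of a circle through the origin, in polar coordinates. -/
theorem chord_le_potential {a b c₁ s₁ c₂ s₂ : ℝ} (h₁ : c₁ ^ 2 + s₁ ^ 2 = 1)
    (h₂ : c₂ ^ 2 + s₂ ^ 2 = 1) (hs₁ : 0 ≤ s₁) (hs₂ : 0 < s₂) (hc₁ : 0 < c₁) (hc₂ : 0 < c₂)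
    (hsin : 0 ≤ c₁ * s₂ - s₁ * c₂) (hcs : s₂ ≤ c₂) (ha : 0 ≤ a) (hab : a ≤ b)
    (hb : 71 / 50 ≤ b) :
    √(1 + a ^ 2) * (c₁ * s₂ - s₁ * c₂) + (c₁ + a * s₁) - (c₂ + a * s₂) ≤
      s₂ - s₁ + b * (c₁ - c₂) := by
  set A := √(1 + a ^ 2)
  have hA0 : 0 ≤ A := Real.sqrt_nonneg _
  have hA2 : A ^ 2 = 1 + a ^ 2 := Real.sq_sqrt (by positivity)
  have hA1 : A ≤ 1 + a := by
    apply Real.sqrt_le_iff.2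
    constructor
    · linarith
    · nlinarith
  have hc2lt : c₂ ≤ 1 := le_one_of_sq_add_sq h₂
  have hA : A + s₂ - a * c₂ ≤ c₂ + b * s₂ := by
    suffices A ≤ (1 + a) * c₂ + (b - 1) * s₂ by linarith
    rcases le_total 1 a with h1 | h1
    · suffices A ≤ (1 + a) * c₂ + (a - 1) * s₂ by nlinarith
      apply Real.sqrt_le_iff.2
      have : 0 ≤ (a - 1) * s₂ := mul_nonneg (by linarith) hs₂.le
      constructor
      · positivity
      · have e : ((1 + a) * c₂ + (a - 1) * s₂) ^ 2 = (1 + a ^ 2) * (c₂ ^ 2 + s₂ ^ 2) +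
          2 * a * ((c₂ - s₂) * (c₂ + s₂)) + 2 * ((a - 1) * s₂) * ((a + 1) * c₂) := by ring
        rw [e, h₂]
        have : 0 ≤ (c₂ - s₂) * (c₂ + s₂) := mul_nonneg (by linarith) (by linarith)
        have : 0 ≤ 2 * a * ((c₂ - s₂) * (c₂ + s₂)) := by positivity
        have : 0 ≤ 2 * ((a - 1) * s₂) * ((a + 1) * c₂) := by positivity
        linarith
    · suffices A ≤ (1 + a) * c₂ + 21 / 50 * s₂ by nlinarith
      -- By convexity √(1 + a²) ≤ 1 + (√2 - 1)a on [0, 1]; the slope 0.415 rounds this up.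
      have hA' : A ≤ 1 + 207 / 500 * a + 1 / 1000 * a := by
        apply Real.sqrt_le_iff.2
        constructor
        · positivity
        · nlinarith
      have hc := (cos_bound h₂ hs₂ hcs).1
      have h0 : 1 - c₂ ≤ 21 / 50 * s₂ := one_sub_cos_le h₂ hs₂ hcs (by norm_num)
      nlinarith
  have hB : A * s₂ + 1 - (c₂ + a * s₂) ≤ s₂ + b * (1 - c₂) := by
    linarith [mul_le_mul_of_nonneg_right hA1 hs₂.le,
      mul_nonneg (show 0 ≤ b - 1 by linarith) (sub_nonneg.2 hc2lt)]
  have hT : (1 - (c₁ * c₂ + s₁ * s₂)) * s₂ ≤ (1 - c₂) * (c₁ * s₂ - s₁ * c₂) := by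
    have e : (1 - c₂) * (c₁ * s₂ - s₁ * c₂) - (1 - (c₁ * c₂ + s₁ * s₂)) * s₂ =
        s₁ * (1 - c₂) - s₂ * (1 - c₁) + s₁ * (c₂ ^ 2 + s₂ ^ 2 - 1) := by ring
    have := one_sub_cos_mul_le h₁ h₂ hs₁ hs₂ hc₁ hc₂ hsin
    rw [h₂] at e
    linarith
  set S := c₁ * s₂ - s₁ * c₂ with hS
  set C := c₁ * c₂ + s₁ * s₂ with hC
  have hC1 : C ≤ 1 := by nlinarith [sq_nonneg (c₁ - c₂), sq_nonneg (s₁ - s₂)]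
  have e1 : c₁ = c₂ * C + s₂ * S := by rw [hS, hC]; linear_combination (-c₁) * h₂
  have e2 : s₁ = s₂ * C - c₂ * S := by rw [hS, hC]; linear_combination (-s₁) * h₂
  rw [e1, e2]
  set k := c₂ + a * s₂ + s₂ - b * c₂ with hk
  -- Here `S` and `C` are sine and cosine of Δ = θ₂ - θ₁. Divided by `S`, the inequality is affine
  -- in tan(Δ/2), which ranges from 0 to tan(θ₂/2) by `hT`. The two ends are `hA` (Δ → 0) and `hB`
  -- (θ₁ = 0).
  suffices S * (A + s₂ - a * c₂ - (c₂ + b * s₂)) ≤ (1 - C) * k by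
    rw [hk] at this
    linarith
  rcases le_total 0 k with hk0 | hk0
  · have : 0 ≤ (1 - C) * k := mul_nonneg (by linarith) hk0
    linarith [mul_nonpos_of_nonneg_of_nonpos hsin (sub_nonpos.2 hA)]
  · refine le_of_mul_le_mul_right (a := s₂) ?_ hs₂
    have h5 : (1 - c₂) * S * k ≤ (1 - C) * s₂ * k := mul_le_mul_of_nonpos_right hT hk0
    have h6 : S * ((A + s₂ - a * c₂ - (c₂ + b * s₂)) * s₂) ≤ S * ((1 - c₂) * k) := by
      apply mul_le_mul_of_nonneg_left _ hsin
      have h7 : (1 - b) * (c₂ ^ 2 + s₂ ^ 2) = 1 - b := by rw [h₂, mul_one]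
      rw [hk]
      linarith
    linarith

/-- The left side is (a + 1) sin θ + (b - 1)(1 - cos θ), and 1 - cos θ ≤ 0.4143 sin θ. The threshold
71/50 is just above √2, which `chord_le_potential` needs for small `a`, yet small enough to leave
room below π/2 here. -/
theorem potential_le_arc {a b c s : ℝ} (h : c ^ 2 + s ^ 2 = 1) (hs : 0 < s) (hcs : s ≤ c)
    (ha : 0 ≤ a) (hb : b = max a (71 / 50)) :
    (c + a * s) - 1 + s + b * (1 - c) ≤ Real.pi / 2 * (√(1 + a ^ 2) * s) := by
  have hc : 0 < c := by linarith
  have hT : 1 - c ≤ 4143 / 10000 * s := one_sub_cos_le h hs hcs le_rfl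
  have hb1 : 71 / 50 ≤ b := hb ▸ le_max_right _ _
  have key : (a + 1) + (b - 1) * (4143 / 10000) ≤ Real.pi / 2 * √(1 + a ^ 2) := by
    have h314 : (157 : ℝ) / 100 ≤ Real.pi / 2 := by linarith [Real.pi_gt_d2]
    refine le_trans ?_ (mul_le_mul_of_nonneg_right h314 (Real.sqrt_nonneg _))
    suffices ((a + 1) + (b - 1) * (4143 / 10000)) / (157 / 100) ≤ √(1 + a ^ 2) by
      linarith
    apply Real.le_sqrt_of_sq_le
    -- After squaring, each case is a quadratic inequality; the hints are squares centred near the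
    -- vertices.
    rcases le_total a (71 / 50) with h1 | h1
    · rw [max_eq_right h1] at hb
      subst hb
      nlinarith [sq_nonneg (a - 4 / 5)]
    · rw [max_eq_left h1] at hb
      subst hb
      nlinarith [sq_nonneg (b - 16567 / 9292)]
  have : (c + a * s) - 1 + s + b * (1 - c) ≤ ((a + 1) + (b - 1) * (4143 / 10000)) * s := by
    nlinarith
  refine this.trans ?_
  rw [← mul_assoc]
  exact mul_le_mul_of_nonneg_right key hs.le

/-- Law of sines: the circle ρ = cos θ + a sin θ has diameter √(1 + a²), and the chord subtends the
angle θ₂ - θ₁ at the origin, which lies on the circle. -/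
theorem chord_eq {a c₁ s₁ c₂ s₂ : ℝ} (h₁ : c₁ ^ 2 + s₁ ^ 2 = 1)
    (h₂ : c₂ ^ 2 + s₂ ^ 2 = 1) (hsin : 0 ≤ c₁ * s₂ - s₁ * c₂) :
    √(((c₁ + a * s₁) * c₁ - (c₂ + a * s₂) * c₂) ^ 2 +
      ((c₁ + a * s₁) * s₁ - (c₂ + a * s₂) * s₂) ^ 2) =
      √(1 + a ^ 2) * (c₁ * s₂ - s₁ * c₂) := by
  rw [Real.sqrt_eq_iff_mul_self_eq (by positivity) (by positivity), ← sq, mul_pow,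
    Real.sq_sqrt (by positivity)]
  set S := c₁ * s₂ - s₁ * c₂ with hS
  set C := c₁ * c₂ + s₁ * s₂ with hC
  set ρ := c₂ + a * s₂ with hρ
  set κ := s₂ - a * c₂ with hκ
  have hCS : C ^ 2 + S ^ 2 = 1 := by
    rw [hS, hC]; linear_combination (c₂ ^ 2 + s₂ ^ 2) * h₁ + h₂
  have hρκ : ρ ^ 2 + κ ^ 2 = 1 + a ^ 2 := by
    rw [hρ, hκ]; linear_combination (1 + a ^ 2) * h₂
  have e : c₁ + a * s₁ = C * ρ + S * κ := by
    rw [hρ, hκ, hC, hS]; linear_combination (-(c₁ + a * s₁)) * h₂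
  rw [e]
  have e' : ((C * ρ + S * κ) * c₁ - ρ * c₂) ^ 2 + ((C * ρ + S * κ) * s₁ - ρ * s₂) ^ 2 =
      (C * ρ + S * κ) ^ 2 * (c₁ ^ 2 + s₁ ^ 2) + ρ ^ 2 * (c₂ ^ 2 + s₂ ^ 2) -
        2 * (C * ρ + S * κ) * ρ * C := by
    rw [hC]; ring
  rw [e', h₁, h₂]
  linear_combination S ^ 2 * hρκ - ρ ^ 2 * hCS

/-- Push the first point radially out to the circle. The detour costs `c₁ + a * s₁ - ρ₁`, exactly
the change of the potential, so the case of two points on the circle suffices. -/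
theorem dist_le_potential_sub {a b c₁ s₁ c₂ s₂ ρ₁ ρ₂ : ℝ} (h₁ : c₁ ^ 2 + s₁ ^ 2 = 1)
    (h₂ : c₂ ^ 2 + s₂ ^ 2 = 1) (hs₁ : 0 ≤ s₁) (hs₂ : 0 < s₂) (hc₁ : 0 < c₁) (hc₂ : 0 < c₂)
    (hsin : 0 ≤ c₁ * s₂ - s₁ * c₂) (hcs : s₂ ≤ c₂) (ha : 0 ≤ a) (hab : a ≤ b)
    (hb : 71 / 50 ≤ b) (hρ₁ : ρ₁ ≤ c₁ + a * s₁) (hρ₂ : ρ₂ = c₂ + a * s₂) :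
    √((ρ₁ * c₁ - ρ₂ * c₂) ^ 2 + (ρ₁ * s₁ - ρ₂ * s₂) ^ 2) ≤
      (ρ₂ + s₂ - b * c₂) - (ρ₁ + s₁ - b * c₁) := by
  have h := chord_le_potential h₁ h₂ hs₁ hs₂ hc₁ hc₂ hsin hcs ha hab hb
  have hch := chord_eq (a := a) h₁ h₂ hsin
  have e1 : ∀ x y x' y' : ℝ, √((x - x') ^ 2 + (y - y') ^ 2) =
      dist (!₂[x, y] : Plane) !₂[x', y'] := by
    intro x y x' y'
    rw [EuclideanSpace.dist_eq]
    simp [Real.dist_eq, sq_abs]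
  rw [e1] at hch ⊢
  have htri := dist_triangle (!₂[ρ₁ * c₁, ρ₁ * s₁] : Plane)
    !₂[(c₁ + a * s₁) * c₁, (c₁ + a * s₁) * s₁] !₂[ρ₂ * c₂, ρ₂ * s₂]
  have hd : dist (!₂[ρ₁ * c₁, ρ₁ * s₁] : Plane)
      !₂[(c₁ + a * s₁) * c₁, (c₁ + a * s₁) * s₁] = c₁ + a * s₁ - ρ₁ := by
    rw [← e1, Real.sqrt_eq_iff_mul_self_eq (by positivity) (by linarith)]
    linear_combination (((c₁ + a * s₁ - ρ₁) ^ 2)) * h₁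
  rw [hd] at htri
  subst hρ₂
  rw [hch] at htri
  linarith

/-- The parameter `(ρ - c) / s` of the circle through the origin, `(1, 0)` and the point with polar
coordinates `(ρ, (c, s))` increases along points having an empty circle through the origin. -/
theorem circle_parameter_mono {w₁ w₂ c₁ s₁ c₂ s₂ ρ₁ ρ₂ : ℝ} (hw : w₁ ≤ 1) (hs₁ : 0 ≤ s₁)
    (hsin : 0 ≤ c₁ * s₂ - s₁ * c₂) (h₁ : ρ₁ = w₁ * c₁ + w₂ * s₁)
    (h₂ : w₁ * c₂ + w₂ * s₂ ≤ ρ₂) : (ρ₁ - c₁) * s₂ ≤ (ρ₂ - c₂) * s₁ := by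
  subst h₁
  linarith [mul_le_mul_of_nonneg_right h₂ hs₁, mul_nonneg (sub_nonneg.2 hw) hsin]

/-! ### Normalised coordinates at the apex -/

/-- `X`, `Y` are Cartesian coordinates of the plane with unit length `N`. -/
structure IsFrame (X Y : Plane →ₗ[ℝ] ℝ) (N : ℝ) : Prop where
  pos : 0 < N
  norm_sq : ∀ v, ‖v‖ ^ 2 = N ^ 2 * (X v ^ 2 + Y v ^ 2)

theorem exists_isFrame (u v : Plane) (hu : u ≠ 0) :
    ∃ X Y : Plane →ₗ[ℝ] ℝ, IsFrame X Y ‖u‖ ∧ X u = 1 ∧ Y u = 0 ∧ 0 ≤ Y v := by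
  have hN : ∀ w : Plane, ‖w‖ ^ 2 = w 0 ^ 2 + w 1 ^ 2 := by
    intro w
    rw [EuclideanSpace.norm_sq_eq]
    simp [Fin.sum_univ_two]
  have hu0 : 0 < ‖u‖ := norm_pos_iff.2 hu
  let e : Fin 2 → Plane →ₗ[ℝ] ℝ := fun i => (EuclideanSpace.proj i : Plane →L[ℝ] ℝ).toLinearMap
  have he : ∀ i w, e i w = w i := fun i w => rfl
  -- The sign reflects the frame, if necessary, to bring `v` into the upper half plane.
  obtain ⟨σ, hσ, hσv⟩ : ∃ σ : ℝ, σ ^ 2 = 1 ∧ 0 ≤ σ * (u 0 * v 1 - u 1 * v 0) := by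
    rcases le_total 0 (u 0 * v 1 - u 1 * v 0) with h | h
    · exact ⟨1, by norm_num, by linarith⟩
    · exact ⟨-1, by norm_num, by linarith⟩
  refine ⟨(‖u‖ ^ 2)⁻¹ • (u 0 • e 0 + u 1 • e 1), (σ * (‖u‖ ^ 2)⁻¹) • (u 0 • e 1 - u 1 • e 0),
    ⟨hu0, fun w => ?_⟩, ?_, ?_, ?_⟩
  · simp only [LinearMap.smul_apply, LinearMap.add_apply, LinearMap.sub_apply, he, smul_eq_mul,
      mul_pow, hσ, one_mul]
    rw [← mul_add]
    have : (u 0 * w 0 + u 1 * w 1) ^ 2 + (u 0 * w 1 - u 1 * w 0) ^ 2 = ‖u‖ ^ 2 * ‖w‖ ^ 2 := by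
      rw [hN, hN]; ring
    rw [this]
    field_simp
  · simp only [LinearMap.smul_apply, LinearMap.add_apply, he, smul_eq_mul]
    rw [show u 0 * u 0 + u 1 * u 1 = ‖u‖ ^ 2 by rw [hN]; ring]
    field_simp
  · simp only [LinearMap.smul_apply, LinearMap.sub_apply, he, smul_eq_mul]
    ring
  · simp only [LinearMap.smul_apply, LinearMap.sub_apply, he, smul_eq_mul]
    have : 0 ≤ (‖u‖ ^ 2)⁻¹ * (σ * (u 0 * v 1 - u 1 * v 0)) := by positivity
    linarith

namespace IsFrame

variable {X Y : Plane →ₗ[ℝ] ℝ} {N : ℝ}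

theorem norm_eq (h : IsFrame X Y N) (v : Plane) : ‖v‖ = N * √(X v ^ 2 + Y v ^ 2) := by
  rw [← Real.sqrt_sq (norm_nonneg v), h.norm_sq, Real.sqrt_mul (by positivity),
    Real.sqrt_sq h.pos.le]

theorem dist_eq (h : IsFrame X Y N) (s v w : Plane) :
    dist v w = N * √((X (v - s) - X (w - s)) ^ 2 + (Y (v - s) - Y (w - s)) ^ 2) := by
  rw [dist_eq_norm, h.norm_eq, ← map_sub, ← map_sub, sub_sub_sub_cancel_right]

theorem ext (h : IsFrame X Y N) {v w : Plane} (hX : X v = X w) (hY : Y v = Y w) : v = w := by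
  have := h.norm_sq (v - w)
  rw [map_sub, map_sub, hX, hY] at this
  rw [← sub_eq_zero, ← norm_eq_zero]
  simpa using this

theorem inner_eq (h : IsFrame X Y N) (v w : Plane) :
    inner ℝ v w = N ^ 2 * (X v * X w + Y v * Y w) := by
  have h1 := norm_add_sq_real v w
  rw [h.norm_sq, h.norm_sq, h.norm_sq] at h1
  simp only [map_add] at h1
  linarith

theorem coneCoordinates (h : IsFrame X Y N) {s x y : Plane}
    (hd : 0 < X (x - s) * Y (y - s) - Y (x - s) * X (y - s)) :
    ∃ l m : Plane →ₗ[ℝ] ℝ, ConeCoordinates s x y l m := by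
  refine ⟨(X (x - s) * Y (y - s) - Y (x - s) * X (y - s))⁻¹ • (Y (y - s) • X - X (y - s) • Y),
    (X (x - s) * Y (y - s) - Y (x - s) * X (y - s))⁻¹ • (X (x - s) • Y - Y (x - s) • X), ?_⟩
  have hd' := hd.ne'
  constructor
  · intro v
    apply h.ext <;>
      simp only [map_add, map_smul, LinearMap.smul_apply, LinearMap.sub_apply, smul_eq_mul] <;>
      field_simp <;> ring
  all_goals
    simp only [LinearMap.smul_apply, LinearMap.sub_apply, smul_eq_mul]
    field_simp
    try ring

/-- A circle through the origin with centre w/2 has equation |v|² = w · v, and its outside is |v|² >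
w · v. -/
theorem hasEmptyCircle (h : IsFrame X Y N) {P : Finset Plane} {s x : Plane}
    (hc : HasEmptyCircle P s x) : ∃ w₁ w₂ : ℝ,
      X (x - s) ^ 2 + Y (x - s) ^ 2 = w₁ * X (x - s) + w₂ * Y (x - s) ∧
      ∀ y ∈ P, w₁ * X (y - s) + w₂ * Y (y - s) ≤ X (y - s) ^ 2 + Y (y - s) ^ 2 := by
  obtain ⟨c, ρ, h1, h2, h3⟩ := hc
  have hN2 : 0 < N ^ 2 := pow_pos h.pos 2
  have hd : ∀ y, dist y c ^ 2 = N ^ 2 * ((X (y - s) - X (c - s)) ^ 2 +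
      (Y (y - s) - Y (c - s)) ^ 2) := by
    intro y
    rw [h.dist_eq s, mul_pow, Real.sq_sqrt (by positivity)]
  have hs := hd s
  rw [h1] at hs
  simp only [sub_self, map_zero, zero_sub, even_two, Even.neg_pow] at hs
  refine ⟨2 * X (c - s), 2 * Y (c - s), ?_, ?_⟩
  · have hx := hd x
    rw [h2, hs] at hx
    have := mul_left_cancel₀ hN2.ne' hx
    linarith
  · intro y hy
    have hρ : ρ ^ 2 ≤ dist y c ^ 2 :=
      pow_le_pow_left₀ (h1 ▸ dist_nonneg) (h3 y hy) 2
    rw [hs, hd y] at hρ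
    have := le_of_mul_le_mul_left hρ hN2
    linarith

theorem mem_wedgeNeighbors (h : IsFrame X Y N) {P : Finset Plane} {G : SimpleGraph P} {s r p : P}
    (hXr : X (r - s) = 1) (hYr : Y (r - s) = 0) (hYp : 0 < Y (p - s)) (x : P) :
    x ∈ wedgeNeighbors G s r p ↔ G.Adj s x ∧ 0 ≤ Y (x - s) ∧
      0 ≤ X (x - s) * Y (p - s) - Y (x - s) * X (p - s) := by
  constructor
  · rintro ⟨hx, u, v, hu, hv, e⟩
    rw [e]
    simp only [map_add, map_smul, smul_eq_mul, hXr, hYr]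
    refine ⟨hx, by positivity, ?_⟩
    have : 0 ≤ u * Y (p - s) := by positivity
    linarith
  · rintro ⟨hx, h1, h2⟩
    refine ⟨hx, (X (x - s) * Y (p - s) - Y (x - s) * X (p - s)) / Y (p - s),
      Y (x - s) / Y (p - s), by positivity, by positivity, ?_⟩
    apply h.ext <;> simp only [map_add, map_smul, smul_eq_mul, hXr, hYr] <;> field_simp <;> ring

/-- Since `sx` is at least as long as `sr`, the vertex `r` lies on the edge `sx`, so it is its end.
-/
theorem eq_of_snd_eq_zero (h : IsFrame X Y N) {P : Finset Plane} {G : SimpleGraph P} {s r x : P}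
    (hG : IsPlaneStraightLine G) (hXr : X (r - s) = 1) (hYr : Y (r - s) = 0) (hsr : G.Adj s r)
    (hsx : G.Adj s x) (hX : 0 ≤ X (x - s)) (hY : Y (x - s) = 0)
    (hmin : 1 ≤ X (x - s) ^ 2 + Y (x - s) ^ 2) : x = r := by
  rw [hY] at hmin
  have h1 : 1 ≤ X (x - s) := by nlinarith
  have h0 : X (x - s) ≠ 0 := by linarith
  have hseg : (r : Plane) ∈ segment ℝ (s : Plane) x := by
    rw [segment_eq_image']
    refine ⟨1 / X (x - s), ⟨by positivity, by rw [div_le_one (by linarith)]; exact h1⟩, ?_⟩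
    refine sub_left_injective (b := (s : Plane)) (h.ext ?_ ?_)
    · simp [hXr, -map_sub, h0]
    · simp [hYr, -map_sub, hY]
  rcases hG.vertex_free s x r hsx hseg with h | h
  · exact absurd h.symm hsr.ne
  · exact h.symm

end IsFrame

/-! ### The fan path and its length -/

theorem walkLength_concat {P : Finset Plane} {G : SimpleGraph P} {a b c : P} (w : G.Walk a b)
    (h : G.Adj b c) : walkLength (w.concat h) = walkLength w + dist (b : Plane) c := by
  simp [walkLength, SimpleGraph.Walk.edges_concat, edgeLength]

/-- The bound for the length of the path from `(1, 0)` to the point `(x, y)`, for a path that stays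
in the disk through the origin, `(1, 0)` and `(cos φ + b sin φ) (cos φ, sin φ)`. -/
noncomputable def pathBound (b x y : ℝ) : ℝ :=
  √(x ^ 2 + y ^ 2) - 1 + y / √(x ^ 2 + y ^ 2) + b * (1 - x / √(x ^ 2 + y ^ 2))

theorem exists_polar {x y : ℝ} (h : 1 ≤ x ^ 2 + y ^ 2) : ∃ ρ c s : ℝ, 1 ≤ ρ ∧
    c ^ 2 + s ^ 2 = 1 ∧ x = ρ * c ∧ y = ρ * s ∧ x ^ 2 + y ^ 2 = ρ ^ 2 ∧
    ∀ b, pathBound b x y = ρ - 1 + s + b * (1 - c) := by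
  have h1 : 1 ≤ √(x ^ 2 + y ^ 2) := Real.one_le_sqrt.2 h
  have h2 : √(x ^ 2 + y ^ 2) ^ 2 = x ^ 2 + y ^ 2 := Real.sq_sqrt (by linarith)
  refine ⟨√(x ^ 2 + y ^ 2), x / √(x ^ 2 + y ^ 2), y / √(x ^ 2 + y ^ 2), h1, ?_, ?_, ?_, h2.symm,
    fun b => rfl⟩
  · rw [div_pow, div_pow, ← add_div, h2, div_self (by linarith)]
  · field_simp
  · field_simp

theorem le_of_polar {ρ₁ c₁ s₁ ρ₂ c₂ s₂ w₁ w₂ : ℝ} (hρ₁ : 1 ≤ ρ₁) (hρ₂ : 1 ≤ ρ₂)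
    (hw : w₁ ≤ 1) (hs₁ : 0 ≤ s₁)
    (hsin : 0 ≤ c₁ * s₂ - s₁ * c₂) (h₁ : ρ₁ ^ 2 = w₁ * (ρ₁ * c₁) + w₂ * (ρ₁ * s₁))
    (h₂ : w₁ * (ρ₂ * c₂) + w₂ * (ρ₂ * s₂) ≤ ρ₂ ^ 2) : (ρ₁ - c₁) * s₂ ≤ (ρ₂ - c₂) * s₁ := by
  refine circle_parameter_mono (w₁ := w₁) (w₂ := w₂) hw hs₁ hsin ?_ ?_
  · refine mul_left_cancel₀ (show ρ₁ ≠ 0 by linarith) ?_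
    linarith
  · refine le_of_mul_le_mul_left (a := ρ₂) ?_ (by linarith)
    linarith

/-- The fan path through the consecutive neighbours of `s` in the wedge. -/
theorem exists_walk_le {P : Finset Plane} {G : SimpleGraph P} (hG : IsDelaunayTriangulation G)
    {s r p : P} {X Y : Plane →ₗ[ℝ] ℝ} {N : ℝ} (hF : IsFrame X Y N)
    (hXr : X (r - s) = 1) (hYr : Y (r - s) = 0) (hYp : 0 < Y (p - s))
    (hXYp : Y (p - s) ≤ X (p - s)) (hsr : G.Adj s r)
    (hmin : ∀ x ∈ wedgeNeighbors G s r p, 1 ≤ X (x - s) ^ 2 + Y (x - s) ^ 2)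
    {ρ c t b : ℝ} (hρ : 1 ≤ ρ) (hct : c ^ 2 + t ^ 2 = 1) (hXp : X (p - s) = ρ * c)
    (hYp' : Y (p - s) = ρ * t) (hb : 71 / 50 ≤ b) (hb' : (ρ - c) / t ≤ b)
    (x : P) (hx : x ∈ wedgeNeighbors G s r p) :
    ∃ w : G.Walk r x, walkLength w ≤ N * pathBound b (X (x - s)) (Y (x - s)) := by
  have hmem := hF.mem_wedgeNeighbors (G := G) hXr hYr hYp
  have hXpos : ∀ x ∈ wedgeNeighbors G s r p, 0 < X (x - s) ∧ Y (x - s) ≤ X (x - s) := by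
    intro x hx
    obtain ⟨-, h1, h2⟩ := (hmem x).1 hx
    have h3 : Y (x - s) ≤ X (x - s) := by
      refine le_of_mul_le_mul_right (a := Y (p - s)) ?_ hYp
      linarith [mul_le_mul_of_nonneg_left hXYp h1]
    refine ⟨?_, h3⟩
    have := hmin x hx
    by_contra! hcon
    have e1 : X (x - s) = 0 := by linarith
    have e2 : Y (x - s) = 0 := by linarith
    rw [e1, e2] at this
    norm_num at this
  have ht : 0 < t := by
    rw [hYp'] at hYp
    exact pos_of_mul_pos_right hYp (by linarith)
  have wf : WellFounded fun x y : P => Y (x - s) / X (x - s) < Y (y - s) / X (y - s) := by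
    have : IsTrans P fun x y : P => Y (x - s) / X (x - s) < Y (y - s) / X (y - s) :=
      ⟨fun _ _ _ h1 h2 => h1.trans h2⟩
    have : Std.Irrefl fun x y : P => Y (x - s) / X (x - s) < Y (y - s) / X (y - s) :=
      ⟨fun _ h => lt_irrefl _ h⟩
    exact Finite.wellFounded_of_trans_of_irrefl _
  induction x using wf.induction with
  | _ x ih =>
  obtain ⟨hsx, hYx, hxp⟩ := (hmem x).1 hx
  obtain ⟨hXx, hYXx⟩ := hXpos x hx
  have hr : r ∈ wedgeNeighbors G s r p := by
    rw [hmem, hXr, hYr]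
    exact ⟨hsr, le_rfl, by linarith⟩
  rcases hYx.eq_or_lt with hY0 | hY0
  · have hxr := hF.eq_of_snd_eq_zero hG.triangulation.prop hXr hYr hsr hsx hXx.le hY0.symm
      (hmin x hx)
    subst hxr
    refine ⟨SimpleGraph.Walk.nil, ?_⟩
    simp [walkLength, pathBound, hXr, hYr, -map_sub]
  · classical
    let Z : Finset P := Finset.univ.filter fun z : P => z ∈ wedgeNeighbors G s r p ∧
      Y (z - s) / X (z - s) < Y (x - s) / X (x - s)
    -- The predecessor of `x` in angular order: a neighbour strictly inside the cone of `q` and `x`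
    -- would have a slope strictly between theirs.
    obtain ⟨q, hq, hmax⟩ := Z.exists_max_image (fun z => Y (z - s) / X (z - s))
      ⟨r, by
        simp only [Z, Finset.mem_filter, Finset.mem_univ, true_and]
        refine ⟨hr, ?_⟩
        rw [hYr, zero_div]
        positivity⟩
    simp only [Z, Finset.mem_filter, Finset.mem_univ, true_and, and_imp] at hq hmax
    obtain ⟨hqw, hqx⟩ := hq
    obtain ⟨hsq, hYq, hqp⟩ := (hmem q).1 hqw
    obtain ⟨hXq, hYXq⟩ := hXpos q hqw
    obtain ⟨w, hw⟩ := ih q hqx hqw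
    rw [div_lt_div_iff₀ hXq hXx] at hqx
    have hdet : 0 < X (q - s) * Y (x - s) - Y (q - s) * X (x - s) := by linarith
    obtain ⟨l, m, hlm⟩ := hF.coneCoordinates hdet
    have hadj : G.Adj q x := by
      refine hlm.adj hG.triangulation hsq hsx ?_
      rintro z hsz ⟨hl, hm⟩
      have eX : X (z - s) = l (z - s) * X (q - s) + m (z - s) * X (x - s) := by
        conv_lhs => rw [hlm.expand (z - s)]
        simp only [map_add, map_smul, smul_eq_mul]
      have eY : Y (z - s) = l (z - s) * Y (q - s) + m (z - s) * Y (x - s) := by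
        conv_lhs => rw [hlm.expand (z - s)]
        simp only [map_add, map_smul, smul_eq_mul]
      have hXz : 0 < X (z - s) := by rw [eX]; positivity
      have hz : z ∈ wedgeNeighbors G s r p := by
        rw [hmem]
        refine ⟨hsz, by rw [eY]; positivity, ?_⟩
        rw [eX, eY]
        linarith [mul_nonneg hl.le hqp, mul_nonneg hm.le hxp]
      have h1 : Y (z - s) / X (z - s) < Y (x - s) / X (x - s) := by
        rw [div_lt_div_iff₀ hXz hXx, eX, eY]
        linarith [mul_pos hl hdet]
      have h2 := hmax z hz h1
      rw [div_le_div_iff₀ hXz hXq, eX, eY] at h2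
      linarith [mul_pos hm hdet]
    refine ⟨w.concat hadj, ?_⟩
    rw [walkLength_concat, hF.dist_eq s]
    obtain ⟨ρ₁, c₁, s₁, hρ₁, h₁, eX₁, eY₁, eR₁, hP₁⟩ := exists_polar (hmin q hqw)
    obtain ⟨ρ₂, c₂, s₂, hρ₂, h₂, eX₂, eY₂, eR₂, hP₂⟩ := exists_polar (hmin x hx)
    obtain ⟨v₁, v₂, hv, hvP⟩ := hF.hasEmptyCircle (hG.empty_circle s q hsq)
    obtain ⟨w₁, w₂, hwx, hwP⟩ := hF.hasEmptyCircle (hG.empty_circle s x hsx)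
    have hv₁ : v₁ ≤ 1 := by
      have := hvP r r.2
      rw [hXr, hYr] at this
      linarith
    have hw₁ : w₁ ≤ 1 := by
      have := hwP r r.2
      rw [hXr, hYr] at this
      linarith
    have hvx := hvP x x.2
    have hwp := hwP p p.2
    rw [hP₁] at hw
    rw [hP₂]
    rw [eR₁] at hv
    rw [eR₂] at hwx hvx
    rw [hXp, hYp', mul_pow, mul_pow, ← mul_add, hct, mul_one] at hwp
    rw [hXp, hYp'] at hxp
    rw [eX₁, eY₁] at hv hYXq hdet ⊢
    rw [eX₁] at hXq
    rw [eY₁] at hYq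
    rw [eX₂] at hXx
    rw [eY₂] at hY0
    rw [eX₂, eY₂] at hwx hvx hdet hxp hYXx ⊢
    have hρ₁' : 0 < ρ₁ := by linarith
    have hρ₂' : 0 < ρ₂ := by linarith
    have hρ' : 0 < ρ := by linarith
    have hs₁ : 0 ≤ s₁ := nonneg_of_mul_nonneg_right hYq hρ₁'
    have hc₁ : 0 < c₁ := pos_of_mul_pos_right hXq hρ₁'.le
    have hs₂ : 0 < s₂ := pos_of_mul_pos_right hY0 hρ₂'.le
    have hc₂ : 0 < c₂ := pos_of_mul_pos_right hXx hρ₂'.le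
    have hcs₂ : s₂ ≤ c₂ := le_of_mul_le_mul_left hYXx hρ₂'
    have hsin : 0 ≤ c₁ * s₂ - s₁ * c₂ := by
      refine nonneg_of_mul_nonneg_right (a := ρ₁ * ρ₂) ?_ (by positivity)
      linarith
    have hsin' : 0 ≤ c₂ * t - s₂ * c := by
      refine nonneg_of_mul_nonneg_right (a := ρ₂ * ρ) ?_ (by positivity)
      linarith
    -- The circle of `sq` does not contain `x`, so `q` lies in the disk through `s`, `r`, `x`. The
    -- circle of `sx` does not contain `p`, so the parameter of `x` is at most that of `p`, hence at
    -- most `b`.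
    have hqa := le_of_polar hρ₁ hρ₂ hv₁ hs₁ hsin hv hvx
    have hxa := le_of_polar hρ₂ hρ hw₁ hs₂.le hsin' hwx hwp
    have hc₂1 : c₂ ≤ 1 := le_one_of_sq_add_sq h₂
    have hstep := dist_le_potential_sub (a := (ρ₂ - c₂) / s₂) (b := b) (ρ₁ := ρ₁) (ρ₂ := ρ₂)
      h₁ h₂ hs₁ hs₂ hc₁ hc₂ hsin hcs₂ (div_nonneg (by linarith) hs₂.le)
      (le_trans ((div_le_div_iff₀ hs₂ ht).2 hxa) hb') hb
      (by
        rw [div_mul_eq_mul_div, ← sub_le_iff_le_add', le_div_iff₀ hs₂]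
        exact hqa)
      (by rw [div_mul_cancel₀ _ hs₂.ne']; ring)
    linarith [mul_le_mul_of_nonneg_left hstep hF.pos.le]

theorem le_of_angle_le {X Y : Plane →ₗ[ℝ] ℝ} {u v : Plane} (hF : IsFrame X Y ‖u‖)
    (hX : X u = 1) (hY : Y u = 0) (hv : v ≠ 0)
    (h : InnerProductGeometry.angle u v ≤ Real.pi / 4) : 0 < X v ∧ Y v ≤ X v := by
  have hcos : √2 / 2 ≤ Real.cos (InnerProductGeometry.angle u v) := by
    rw [← Real.cos_pi_div_four]
    exact Real.cos_le_cos_of_nonneg_of_le_pi (InnerProductGeometry.angle_nonneg _ _)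
      (by linarith [Real.pi_pos]) h
  have hu := hF.pos
  have hv' : 0 < ‖v‖ := norm_pos_iff.2 hv
  rw [InnerProductGeometry.cos_angle, le_div_iff₀ (by positivity), hF.inner_eq, hX, hY,
    zero_mul, add_zero, one_mul] at hcos
  have h2 : (0 : ℝ) < √2 := by positivity
  have hXv : 0 < X v := by
    have : 0 < ‖u‖ ^ 2 * X v := lt_of_lt_of_le (by positivity) hcos
    exact pos_of_mul_pos_right this (by positivity)
  refine ⟨hXv, ?_⟩
  have hsq := pow_le_pow_left₀ (by positivity) hcos 2
  have e : (√2 / 2 * (‖u‖ * ‖v‖)) ^ 2 = ‖u‖ ^ 2 * ‖u‖ ^ 2 * ((X v ^ 2 + Y v ^ 2) / 2) := by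
    rw [mul_pow, div_pow, mul_pow, Real.sq_sqrt (by norm_num), hF.norm_sq v]
    ring
  rw [e, show (‖u‖ ^ 2 * X v) ^ 2 = ‖u‖ ^ 2 * ‖u‖ ^ 2 * X v ^ 2 by ring] at hsq
  have := le_of_mul_le_mul_left hsq (by positivity)
  exact le_of_abs_le (abs_le_of_sq_le_sq (by linarith) hXv.le)

theorem mainTheorem4 (P : Finset Plane) (G : SimpleGraph P) (hG : IsDelaunayTriangulation G)
    (s r p : P) (hsr : G.Adj s r) (hsp : G.Adj s p)
    (hangle : EuclideanGeometry.angle (r : Plane) (s : Plane) (p : Plane) ≤ Real.pi / 4)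
    (hshort : ∀ e ∈ wedge G s r p, edgeLength s(s, r) ≤ edgeLength e) :
    graphDist G r p ≤ ENNReal.ofReal (Real.pi / 2 * dist (r : Plane) (p : Plane)) := by
  suffices ∃ w : G.Walk r p, walkLength w ≤ Real.pi / 2 * dist (r : Plane) (p : Plane) by
    obtain ⟨w, hw⟩ := this
    exact (iInf_le _ w).trans (ENNReal.ofReal_le_ofReal hw)
  have hu : (r : Plane) - s ≠ 0 := sub_ne_zero.2 fun h => hsr.ne (Subtype.ext h.symm)
  have hv : (p : Plane) - s ≠ 0 := sub_ne_zero.2 fun h => hsp.ne (Subtype.ext h.symm)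
  obtain ⟨X, Y, hF, hXr, hYr, hYp⟩ := exists_isFrame ((r : Plane) - s) ((p : Plane) - s) hu
  obtain ⟨hXp, hXYp⟩ := le_of_angle_le hF hXr hYr hv hangle
  have hmin : ∀ x ∈ wedgeNeighbors G s r p, 1 ≤ X (x - s) ^ 2 + Y (x - s) ^ 2 := by
    intro x hx
    have h1 : dist (s : Plane) r ≤ dist (s : Plane) x := hshort _ ⟨x, hx, rfl⟩
    rw [dist_comm, dist_eq_norm, dist_comm, dist_eq_norm, hF.norm_eq ((x : Plane) - s)] at h1
    exact Real.one_le_sqrt.1 ((le_mul_iff_one_le_right hF.pos).1 h1)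
  have hp : p ∈ wedgeNeighbors G s r p := ⟨hsp, 0, 1, le_rfl, zero_le_one, by simp⟩
  obtain ⟨ρ, c, t, hρ, hct, eX, eY, -, hP⟩ := exists_polar (hmin p hp)
  rcases hYp.eq_or_lt with hY0 | hY0
  · have hrp := hF.eq_of_snd_eq_zero hG.triangulation.prop hXr hYr hsr hsp hXp.le hY0.symm
      (hmin p hp)
    subst hrp
    exact ⟨SimpleGraph.Walk.nil, by simp [walkLength]⟩
  · obtain ⟨w, hw⟩ := exists_walk_le hG hF hXr hYr hY0 hXYp hsr hmin hρ hct eX eY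
      (le_max_right ((ρ - c) / t) (71 / 50)) (le_max_left _ _) p hp
    refine ⟨w, hw.trans ?_⟩
    have hρ' : 0 < ρ := by linarith
    rw [eY] at hY0
    rw [eX, eY] at hXYp
    have ht : 0 < t := pos_of_mul_pos_right hY0 hρ'.le
    have htc : t ≤ c := le_of_mul_le_mul_left hXYp hρ'
    have hc1 : c ≤ 1 := le_one_of_sq_add_sq hct
    have ha : 0 ≤ (ρ - c) / t := div_nonneg (by linarith) ht.le
    have hfin := potential_le_arc hct ht htc ha rfl
    have eρ : c + (ρ - c) / t * t = ρ := by rw [div_mul_cancel₀ _ ht.ne']; ring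
    -- `r` is the point at angle 0 on the circle through `s`, `r`, `p`, so this chord is `rp`.
    have hch := chord_eq (a := (ρ - c) / t) (c₁ := 1) (s₁ := 0) (by norm_num) hct
      (by simpa using ht.le)
    rw [eρ] at hfin hch
    rw [hF.dist_eq s, hP, hXr, hYr, eX, eY]
    simp only [mul_zero, add_zero, mul_one, one_mul, zero_mul, sub_zero] at hch
    rw [hch]
    linarith [mul_le_mul_of_nonneg_left hfin hF.pos.le]
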